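/- A dataset is a finite multiset $X$ of points of $\mathbb R^d$, of size $|X|$ (counted with multiplicity); two datasets are neighboring if omitting a single data point from one of them yields the other. A positive-definite shift-invariant (PDSI) kernel on $\mathbb R^d$ is a function $k:\mathbb R^d\times\mathbb R^d\to[0,1]$ such that $k(x+z,y+z)=k(x,y)$ for all $x,y,z\in\mathbb R^d$ and such that for all finite families $x_1,\dots,x_m\in\mathbb R^d$ the matrix $(k(x_i,x_j))_{i,j}$ is symmetric positive semidefinite. For a nonempty dataset $X$ let $KDE_X(y)=\frac1{|X|}\sum_{x\in X}k(x,y)$. A function release mechanism consists of a curator, which maps each dataset $X$ to a random description $M(X)$ (with values in some measurable space $\mathcal O$), and a client, which computes from a description $o\in\mathcal O$ and a query $y\in\mathbb R^d$ a value $\hat e_o(y)\in[0,1]$, measurable in $o$ for each $y$. It is $\epsilon$-DP if $\Pr[M(X)\in O]\le e^{\epsilon}\Pr[M(X')\in O]$ for all neighboring datasets $X,X'$ and all measurable $O\subseteq\mathcal O$. It gives an $(\alpha,\eta)$-approximation of $KDE_X$ if for every $y\in\mathbb R^d$, $\Pr\big[|\hat e_{M(X)}(y)-KDE_X(y)|\le\alpha\big]\ge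 1-\eta$. **Theorem.** There is an absolute constant $C>0$ such that for every $d$, every PDSI kernel $k$ on $\mathbb R^d$, every $\epsilon>0$ and all $\alpha,\eta\in(0,1)$, there is an $\epsilon$-DP function release mechanism that gives an $(\alpha,\eta)$-approximation of $KDE_X$ for every dataset $X$ in $\mathbb R^d$ of size $$|X|\ \ge\ C\cdot\frac{\log(1/\eta)}{\epsilon\alpha^2}.$$ -/

import Mathlib

open MeasureTheory

/-- A positive-definite shift-invariant kernel with values in `[0,1]` (in the usual terminology
for kernels, "positive definite" means that all Gram matrices are symmetric and positive
semidefinite). -/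
structure IsPDSIKernel {E : Type} [AddGroup E] (k : E → E → ℝ) : Prop where
  mem_Icc : ∀ x y, k x y ∈ Set.Icc (0 : ℝ) 1
  shift_invariant : ∀ x y z, k (x + z) (y + z) = k x y
  posDef : ∀ (m : ℕ) (x : Fin m → E), (Matrix.of fun i j => k (x i) (x j)).PosSemidef

/-- The kernel density estimate `KDE_X(y) = (1/|X|) ∑_{x ∈ X} k(x,y)` of a dataset `X`. -/
noncomputable def kde {E : Type} (k : E → E → ℝ) (X : Multiset E) (y : E) : ℝ :=
  (X.map fun x => k x y).sum / (X.card : ℝ)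

/-- Omitting a single data point from one of the two datasets yields the other. -/
def Neighboring {E : Type} (X X' : Multiset E) : Prop :=
  ∃ x : E, X = x ::ₘ X' ∨ X' = x ::ₘ X

/-- A mechanism in the function release model: on a dataset `X` the curator releases a random
description, with law `curator X`, without seeing any query; from a description `o` and a query `y`
the client computes the value `client o y ∈ [0,1]` of the released function at `y`. -/
structure FunctionReleaseMechanism (E : Type) where
  Desc : Type
  [measurableSpace : MeasurableSpace Desc]
  curator : Multiset E → Measure Desc
  isProbabilityMeasure : ∀ X, IsProbabilityMeasure (curator X)
  client : Desc → E → Set.Icc (0 : ℝ) 1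
  measurable_client : ∀ y, Measurable fun o => client o y

attribute [instance] FunctionReleaseMechanism.measurableSpace
attribute [instance] FunctionReleaseMechanism.isProbabilityMeasure

namespace FunctionReleaseMechanism

variable {E : Type}

/-- Pure `ε`-differential privacy of the released description. -/
def IsDP (M : FunctionReleaseMechanism E) (ε : ℝ) : Prop :=
  ∀ X X' : Multiset E, Neighboring X X' → ∀ O : Set M.Desc, MeasurableSet O →
    M.curator X O ≤ ENNReal.ofReal (Real.exp ε) * M.curator X' O

/-- On the dataset `X`, the released function is an `(α,η)`-approximation of `KDE_X`: for each
query separately, the error is at most `α` with probability at least `1 - η`. -/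
def Approximates (M : FunctionReleaseMechanism E) (k : E → E → ℝ) (α η : ℝ)
    (X : Multiset E) : Prop :=
  ∀ y : E, ENNReal.ofReal (1 - η) ≤
    M.curator X {o | |(M.client o y : ℝ) - kde k X y| ≤ α}

end FunctionReleaseMechanism

/-! The kernel is first written as `k x y = E[2 φ(x) φ(y)]` for a random function `φ` with values in
`[-1,1]`. No continuity is assumed, so Bochner's theorem is replaced by finite Fourier analysis on
`(ZMod M)^S`, followed by weak-star compactness of the probability measures on `[-1,1]^E`
(`exists_random_features`).

The curator then plays `J` independent rounds. A round draws `φ`, picks a random point of `X` padded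
with dummy points of total weight `3m`, and releases `φ` with a mark: a data point `x` gives a sign
of mean `φ(x)`, a dummy gives one of three marks uniformly. Each mark has weight at least `m`, and
one data point changes weights by at most 1, so a round costs a factor `1 + 1/m`. With `m = J/ε` the
`J` rounds are `ε`-DP. The law of `φ` itself does not depend on `X`.

The client does not know `|X|`. It divides two sums, whose means per round are `∑ k(x,y)/(3m+|X|)`
and `|X|/(3m+|X|)`; the dilution by dummies cancels. Once `|X| ≥ 3m` the second mean is at least
`1/2`, and Hoeffding bounds the failure probability for error `β` by `3 exp(-Jβ²/512)`
(`featureMechanism_error`).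

For `η` bounded away from 1, `J` of order `log(1/η)/α²` suffices. For `η` near 1 this number is too
small for the union bound to say anything, but a success probability of only `1 - η ≤ log(1/η)` is
needed: a coarser estimate is shifted by a random point of a grid with `N` points, which divides
both the error and the success probability by `N`. -/

/-! ### Bounded random features: finite Fourier analysis and compactness -/

/-- A positive semidefinite matrix over a finite abelian group, averaged along the diagonals, is a
nonnegative combination of characters. -/
lemma exists_nonneg_character_weights {G : Type} [AddCommGroup G] [Fintype G] (K : Matrix G G ℝ)
    (hK : K.PosSemidef) :
    ∃ w : AddChar G ℂ → ℝ, (∀ ψ, 0 ≤ w ψ) ∧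
      ∀ c : G, ∑ ψ, w ψ * (ψ c).re = (∑ a, K a (a + c)) / Fintype.card G := by
  classical
  have hcard : (Fintype.card G : ℝ) ≠ 0 := by
    exact_mod_cast Fintype.card_ne_zero
  have hre (ψ : AddChar G ℂ) (a b : G) :
      (ψ (a - b)).re = (ψ a).re * (ψ b).re + (ψ a).im * (ψ b).im := by
    rw [sub_eq_add_neg, AddChar.map_add_eq_mul, AddChar.map_neg_eq_conj]
    simp
  have hquad (v : G → ℝ) : 0 ≤ ∑ a, ∑ b, K a b * (v a * v b) := by
    have := hK.dotProduct_mulVec_nonneg v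
    simp only [dotProduct, Matrix.mulVec, Finset.mul_sum, star_trivial] at this
    refine this.trans_eq (Finset.sum_congr rfl fun a _ => Finset.sum_congr rfl fun b _ => by ring)
  have hsymm (a b : G) : K a b = K b a := by
    have := hK.isHermitian.apply a b
    simpa using this.symm
  have hsum (c : G) : ∑ ψ : AddChar G ℂ, (ψ c).re = if c = 0 then (Fintype.card G : ℝ) else 0 := by
    rw [← Complex.re_sum, AddChar.sum_apply_eq_ite]
    split_ifs <;> simp
  -- The weight is the quadratic form of `K` at the character `ψ`, split into real and imaginary
  -- parts; Fourier inversion recovers the diagonal averages.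
  refine ⟨fun ψ => (∑ a, ∑ b, K a b * (ψ (a - b)).re) / (Fintype.card G : ℝ) ^ 2, fun ψ => ?_,
    fun c => ?_⟩
  · refine div_nonneg ?_ (by positivity)
    have h := add_nonneg (hquad fun a => (ψ a).re) (hquad fun a => (ψ a).im)
    refine h.trans_eq ?_
    simp only [← Finset.sum_add_distrib, hre]
    exact Finset.sum_congr rfl fun a _ => Finset.sum_congr rfl fun b _ => by ring
  · have hprod (ψ : AddChar G ℂ) (a b : G) : (ψ (a - b)).re * (ψ c).re
        = ((ψ (a - b + c)).re + (ψ (a - b - c)).re) / 2 := by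
      rw [hre ψ (a - b) c, AddChar.map_add_eq_mul, Complex.mul_re]
      ring
    have hpair (a b : G) : ∑ ψ : AddChar G ℂ, (ψ (a - b)).re * (ψ c).re
        = (Fintype.card G : ℝ) / 2 * ((if b = a + c then 1 else 0) + if b = a - c then 1 else 0) := by
      simp only [hprod, ← Finset.sum_div, Finset.sum_add_distrib, hsum]
      have h1 : a - b + c = 0 ↔ b = a + c := by
        constructor <;> intro h
        · rw [← sub_eq_zero, ← neg_eq_zero, ← h]; abel
        · rw [h]; abel
      have h2 : a - b - c = 0 ↔ b = a - c := by
        constructor <;> intro h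
        · rw [← sub_eq_zero, ← neg_eq_zero, ← h]; abel
        · rw [h]; abel
      simp only [h1, h2]
      split_ifs <;> ring
    have hshift : ∑ a, K a (a - c) = ∑ a, K a (a + c) := by
      rw [← Equiv.sum_comp (Equiv.addRight c)]
      exact Finset.sum_congr rfl fun a _ => by
        simp only [Equiv.coe_addRight, add_sub_cancel_right]
        exact hsymm _ _
    calc ∑ ψ : AddChar G ℂ, (∑ a, ∑ b, K a b * (ψ (a - b)).re) / (Fintype.card G : ℝ) ^ 2 * (ψ c).re
        = (∑ ψ : AddChar G ℂ, ∑ a, ∑ b, K a b * ((ψ (a - b)).re * (ψ c).re))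
            / (Fintype.card G : ℝ) ^ 2 := by
          rw [Finset.sum_div]
          refine Finset.sum_congr rfl fun ψ _ => ?_
          rw [div_mul_eq_mul_div, Finset.sum_mul]
          congr 1
          refine Finset.sum_congr rfl fun a _ => ?_
          rw [Finset.sum_mul]
          exact Finset.sum_congr rfl fun b _ => by ring
      _ = (∑ a, ∑ b, K a b * ∑ ψ : AddChar G ℂ, (ψ (a - b)).re * (ψ c).re)
            / (Fintype.card G : ℝ) ^ 2 := by
          rw [Finset.sum_comm]
          congr 1
          refine Finset.sum_congr rfl fun a _ => ?_
          rw [Finset.sum_comm]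
          exact Finset.sum_congr rfl fun b _ => by rw [Finset.mul_sum]
      _ = ((Fintype.card G : ℝ) / 2 * (∑ a, K a (a + c) + ∑ a, K a (a - c)))
            / (Fintype.card G : ℝ) ^ 2 := by
          congr 1
          rw [← Finset.sum_add_distrib, Finset.mul_sum]
          refine Finset.sum_congr rfl fun a _ => ?_
          simp only [hpair, mul_add, Finset.sum_add_distrib, mul_ite, mul_one, mul_zero,
            Finset.sum_ite_eq', Finset.mem_univ, if_true]
          ring
      _ = _ := by
          rw [hshift]
          field_simp
          ring

/-- The combination of the points of `S` whose coefficients are the representatives in `[0, M)` of the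
entries of `a`. -/
noncomputable def latticePoint {E : Type} [AddCommGroup E] (S : Finset E) (M : ℕ)
    (a : S → ZMod M) : E :=
  ∑ u : S, (a u).val • (u : E)

/-- The lattice map is not a homomorphism; it fails to be additive only where a coordinate wraps
around, here at `-1`. -/
lemma latticePoint_add_single {E : Type} [AddCommGroup E] [DecidableEq E] (S : Finset E) (M : ℕ)
    [NeZero M] (a : S → ZMod M) (s : S) (hs : a s ≠ -1) :
    latticePoint S M (a + Pi.single s 1) = latticePoint S M a + s := by
  have hval : (a s + 1).val = (a s).val + 1 := by
    have hlt : (a s).val + 1 < M := by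
      refine lt_of_le_of_ne (ZMod.val_lt (a s)) fun h => hs ?_
      have h' : (((a s).val + 1 : ℕ) : ZMod M) = 0 := by rw [h, ZMod.natCast_self]
      push_cast at h'
      rw [ZMod.natCast_zmod_val] at h'
      exact eq_neg_of_add_eq_zero_left h'
    have h1 : (1 : ZMod M).val = 1 := ZMod.val_one'' (by omega)
    rw [ZMod.val_add_of_lt (by rwa [h1]), h1]
  have h (u : S) : ((a + Pi.single s 1 : S → ZMod M) u).val • (u : E)
      = (a u).val • (u : E) + if u = s then (u : E) else 0 := by
    by_cases hu : u = s
    · subst hu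
      simp [hval, add_smul]
    · simp [hu]
  rw [latticePoint, Finset.sum_congr rfl fun u _ => h u, Finset.sum_add_distrib]
  simp [latticePoint, -Finset.univ_eq_attach]

lemma card_filter_apply_eq {ι : Type} [Fintype ι] [DecidableEq ι] (M : ℕ) [NeZero M] (i : ι)
    (z : ZMod M) :
    ((Finset.univ.filter fun a : ι → ZMod M => a i = z).card : ℝ)
      = Fintype.card (ι → ZMod M) / M := by
  have h := Fintype.card_filter_piFinset_const_eq_of_mem (Finset.univ : Finset (ZMod M)) i
    (Finset.mem_univ z)
  rw [Fintype.piFinset_univ] at h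
  have hM : (M : ℝ) ≠ 0 := by exact_mod_cast NeZero.ne M
  have hι : Fintype.card ι ≠ 0 := (Fintype.card_pos_iff.2 ⟨i⟩).ne'
  rw [h, Fintype.card_fun, Finset.card_univ, ZMod.card]
  push_cast
  rw [eq_div_iff hM, pow_sub_one_mul hι]

/-- A weak-star compactness principle: if any finitely many of the integral constraints can be met
approximately, then all of them can be met exactly. -/
lemma exists_probabilityMeasure_integral_eq {Y : Type} [TopologicalSpace Y] [CompactSpace Y]
    [T2Space Y] [MeasurableSpace Y] [BorelSpace Y] {ι : Type} (F : ι → BoundedContinuousFunction Y ℝ)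
    (c : ι → ℝ)
    (h : ∀ (T : Finset ι) (δ : ℝ), 0 < δ → ∃ μ : ProbabilityMeasure Y, ∀ i ∈ T,
      |∫ y, F i y ∂(μ : Measure Y) - c i| ≤ δ) :
    ∃ μ : ProbabilityMeasure Y, ∀ i, ∫ y, F i y ∂(μ : Measure Y) = c i := by
  classical
  let Z : ι × ℕ → Set (ProbabilityMeasure Y) := fun p =>
    {μ | |∫ y, F p.1 y ∂(μ : Measure Y) - c p.1| ≤ 1 / ((p.2 : ℝ) + 1)}
  have hcont (i : ι) : Continuous fun μ : ProbabilityMeasure Y => ∫ y, F i y ∂(μ : Measure Y) :=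
    continuous_iff_continuousAt.2 fun μ =>
      (ProbabilityMeasure.tendsto_iff_forall_integral_tendsto.1 Filter.tendsto_id) (F i)
  have hclosed (p : ι × ℕ) : IsClosed (Z p) :=
    isClosed_le (((hcont p.1).sub continuous_const).abs) continuous_const
  -- Finite intersection property: finitely many constraints follow from the strictest tolerance
  -- among them.
  have hne : (Set.univ ∩ ⋂ p, Z p).Nonempty := by
    refine isCompact_univ.inter_iInter_nonempty Z hclosed fun u => ?_
    obtain ⟨μ, hμ⟩ := h (u.image Prod.fst) (1 / (((u.sup Prod.snd : ℕ) : ℝ) + 1)) (by positivity)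
    refine ⟨μ, Set.mem_univ _, Set.mem_iInter₂.2 fun p hp => ?_⟩
    refine (hμ p.1 (Finset.mem_image_of_mem _ hp)).trans ?_
    have : p.2 ≤ u.sup Prod.snd := Finset.le_sup (f := Prod.snd) hp
    have : (p.2 : ℝ) ≤ ((u.sup Prod.snd : ℕ) : ℝ) := by exact_mod_cast this
    gcongr
  obtain ⟨μ, -, hμ⟩ := hne
  refine ⟨μ, fun i => ?_⟩
  rw [← sub_eq_zero, ← abs_eq_zero]
  refine le_antisymm (ge_of_tendsto' tendsto_one_div_add_atTop_nhds_zero_nat fun n => ?_)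
    (abs_nonneg _)
  exact Set.mem_iInter.1 hμ (i, n)

namespace IsPDSIKernel

variable {E : Type} {k : E → E → ℝ}

lemma posSemidef_of_fintype [AddGroup E] (hk : IsPDSIKernel k) {G : Type} [Fintype G] (x : G → E) :
    (Matrix.of fun a b => k (x a) (x b)).PosSemidef := by
  have h := (hk.posDef (Fintype.card G) (x ∘ (Fintype.equivFin G).symm)).submatrix
    (Fintype.equivFin G)
  convert h using 1
  ext a b
  simp

lemma symm [AddGroup E] (hk : IsPDSIKernel k) (x y : E) : k x y = k y x := by
  have h := (hk.posSemidef_of_fintype (fun b : Bool => if b then x else y)).isHermitian.apply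
    false true
  simpa using h

lemma apply_self [AddGroup E] (hk : IsPDSIKernel k) (x : E) : k x x = k 0 0 := by
  simpa using hk.shift_invariant 0 0 x

lemma apply_add_sub [AddCommGroup E] (hk : IsPDSIKernel k) (x s t : E) :
    k x (x - t + s) = k s t := by
  rw [hk.symm s t]
  have h := hk.shift_invariant t s (x - t)
  rw [← h]
  congr 1 <;> abel

/-- On finitely many points, the kernel is approximately a mixture of characters of a finite
abelian group. -/
lemma exists_character_weights [AddCommGroup E] [DecidableEq E] (hk : IsPDSIKernel k)
    (S : Finset E) (M : ℕ) [NeZero M] :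
    ∃ w : AddChar (S → ZMod M) ℂ → ℝ, (∀ ψ, 0 ≤ w ψ) ∧ ∑ ψ, w ψ = k 0 0 ∧
      ∀ s t : S, |∑ ψ, w ψ * (ψ (Pi.single s 1 - Pi.single t 1)).re - k s t| ≤ 2 / M := by
  obtain ⟨w, hw, hsum⟩ := exists_nonneg_character_weights _
    (hk.posSemidef_of_fintype (latticePoint S M))
  set n : ℝ := (Fintype.card (S → ZMod M) : ℝ) with hn
  have hn0 : 0 < n := by
    rw [hn]; exact_mod_cast Fintype.card_pos
  refine ⟨w, hw, ?_, fun s t => ?_⟩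
  · have h := hsum 0
    simp only [AddChar.map_zero_eq_one, Complex.one_re, mul_one, add_zero, Matrix.of_apply,
      hk.apply_self, Finset.sum_const, Finset.card_univ, nsmul_eq_mul] at h
    rw [h, ← hn]
    field_simp
  · rw [hsum]
    simp only [Matrix.of_apply]
    let e : S → ZMod M := Pi.single t 1
    -- Without wrap-around, the two lattice points are `z + t` and `z + s` with `z` the image of `a
    -- - e`, so shift invariance gives exactly `k s t`. Each wrap-around excludes one value of one
    -- coordinate, a fraction `1/M` of all `a`. The term `e s` covers the case `s = t`.
    have hbound (a : S → ZMod M) :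
        |k (latticePoint S M a) (latticePoint S M (a + (Pi.single s 1 - Pi.single t 1))) - k s t|
          ≤ (if a t = 0 then 1 else 0) + if a s = -1 + e s then 1 else 0 := by
      have h01 := hk.mem_Icc (latticePoint S M a)
        (latticePoint S M (a + (Pi.single s 1 - Pi.single t 1)))
      have h01' := hk.mem_Icc s t
      have hle : |k (latticePoint S M a)
          (latticePoint S M (a + (Pi.single s 1 - Pi.single t 1))) - k s t| ≤ 1 := by
        rw [abs_le]
        constructor <;> linarith [h01.1, h01.2, h01'.1, h01'.2]
      by_cases ht : a t = 0
      · rw [if_pos ht]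
        split_ifs <;> linarith
      by_cases hs : a s = -1 + e s
      · rw [if_pos hs, if_neg ht]
        linarith
      rw [if_neg ht, if_neg hs]
      have h1 : latticePoint S M (a - e + Pi.single t 1) = latticePoint S M (a - e) + t :=
        latticePoint_add_single S M (a - e) t fun h => ht (by simpa [e] using h)
      have h2 : latticePoint S M (a - e + Pi.single s 1) = latticePoint S M (a - e) + s :=
        latticePoint_add_single S M (a - e) s fun h => hs (by
          rw [← h]; simp)
      rw [show a - e + Pi.single t 1 = a from sub_add_cancel _ _] at h1
      have h3 : a + (Pi.single s 1 - Pi.single t 1) = a - e + Pi.single s 1 := by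
        simp only [e]; abel
      rw [h3, h2, eq_sub_of_add_eq h1.symm, hk.apply_add_sub]
      simp
    have hcard (u : S) (z : ZMod M) :
        ∑ a : S → ZMod M, (if a u = z then (1 : ℝ) else 0) = n / M := by
      rw [Finset.sum_boole, card_filter_apply_eq]
    calc _ = |∑ a, (k (latticePoint S M a)
              (latticePoint S M (a + (Pi.single s 1 - Pi.single t 1))) - k s t)| / n := by
          rw [Finset.sum_sub_distrib, Finset.sum_const, Finset.card_univ, nsmul_eq_mul, ← hn,
            ← abs_of_pos hn0, ← abs_div, abs_of_pos hn0, sub_div, mul_div_cancel_left₀ _ hn0.ne']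
      _ ≤ (∑ a : S → ZMod M, ((if a t = 0 then 1 else 0) + if a s = -1 + e s then 1 else 0)) / n := by
          gcongr
          exact (Finset.abs_sum_le_sum_abs _ _).trans (Finset.sum_le_sum fun a _ => hbound a)
      _ = 2 / M := by
          rw [Finset.sum_add_distrib, hcard, hcard]
          field_simp
          ring

/-- On finitely many points, the kernel is approximately twice the correlation of a finitely
supported random `[-1,1]`-valued function. -/
lemma exists_finite_features [AddCommGroup E] (hk : IsPDSIKernel k)
    (S : Finset E) {δ : ℝ} (hδ : 0 < δ) :
    ∃ (I : Type) (_ : Fintype I) (W : I → ℝ) (p : I → E → Set.Icc (-1 : ℝ) 1),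
      (∀ i, 0 ≤ W i) ∧ ∑ i, W i = 1 ∧
      ∀ s ∈ S, ∀ t ∈ S, |∑ i, W i * (2 * (p i s : ℝ) * p i t) - k s t| ≤ δ := by
  classical
  obtain ⟨m, hm⟩ := exists_nat_gt (2 / δ)
  have hm0 : (0 : ℝ) < m := lt_trans (by positivity) hm
  have : NeZero m := ⟨by rintro rfl; simp at hm0⟩
  obtain ⟨w, hw, hw1, hwk⟩ := hk.exists_character_weights S m
  have hnorm (ψ : AddChar (S → ZMod m) ℂ) (a : S → ZMod m) : ‖ψ a‖ = 1 := AddChar.norm_apply ψ a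
  let part (b : Bool) (z : ℂ) : ℝ := if b then z.re else z.im
  have hpart (b : Bool) (ψ : AddChar (S → ZMod m) ℂ) (a : S → ZMod m) :
      part b (ψ a) ∈ Set.Icc (-1 : ℝ) 1 := by
    refine abs_le.1 ?_
    rw [← hnorm ψ a]
    cases b
    · exact Complex.abs_im_le_norm _
    · exact Complex.abs_re_le_norm _
  -- A feature is the real or imaginary part of a character, chosen with equal probability; the
  -- factor 2 in the correlation undoes this choice. The index `none` is a zero feature carrying the
  -- missing mass `1 - k 0 0`.
  let p : Option (AddChar (S → ZMod m) ℂ × Bool) → E → Set.Icc (-1 : ℝ) 1 := fun i x =>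
    i.elim ⟨0, by norm_num⟩ fun q => if hx : x ∈ S then
      ⟨part q.2 (q.1 (Pi.single ⟨x, hx⟩ 1)), hpart _ _ _⟩ else ⟨0, by norm_num⟩
  refine ⟨Option (AddChar (S → ZMod m) ℂ × Bool), inferInstance,
    fun i => i.elim (1 - k 0 0) fun q => w q.1 / 2, p, ?_, ?_, ?_⟩
  · rintro (_ | q)
    · exact sub_nonneg.2 (hk.mem_Icc 0 0).2
    · exact div_nonneg (hw _) zero_le_two
  · rw [Fintype.sum_option, Fintype.sum_prod_type]
    simp only [Option.elim, Fintype.sum_bool, add_halves, hw1]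
    ring
  · intro s hs t ht
    rw [Fintype.sum_option, Fintype.sum_prod_type]
    have h : ∀ ψ : AddChar (S → ZMod m) ℂ, (ψ (Pi.single ⟨s, hs⟩ 1 - Pi.single ⟨t, ht⟩ 1)).re
        = (ψ (Pi.single ⟨s, hs⟩ 1)).re * (ψ (Pi.single ⟨t, ht⟩ 1)).re
          + (ψ (Pi.single ⟨s, hs⟩ 1)).im * (ψ (Pi.single ⟨t, ht⟩ 1)).im := fun ψ => by
      rw [sub_eq_add_neg, AddChar.map_add_eq_mul, AddChar.map_neg_eq_conj]
      simp
    have h2 := hwk ⟨s, hs⟩ ⟨t, ht⟩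
    have h3 : 2 / (m : ℝ) ≤ δ := by
      rw [div_le_iff₀ hm0]
      rw [div_lt_iff₀ hδ] at hm
      linarith
    refine le_trans (le_of_eq ?_) (h2.trans h3)
    congr 2
    simp only [p, Option.elim, dif_pos hs, dif_pos ht, Fintype.sum_bool, part, h, if_true,
      Bool.false_eq_true, if_false, mul_zero, zero_add]
    exact Finset.sum_congr rfl fun ψ _ => by ring

/-- Bounded random features: a positive-definite shift-invariant kernel, even a discontinuous one,
is twice the correlation of a random `[-1,1]`-valued function. -/
theorem exists_random_features [AddCommGroup E] (hk : IsPDSIKernel k) :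
    ∃ (Ω : Type) (_ : MeasurableSpace Ω) (P : Measure Ω) (φ : Ω → E → ℝ),
      IsProbabilityMeasure P ∧ (∀ x, Measurable fun ω => φ ω x) ∧
      (∀ ω x, φ ω x ∈ Set.Icc (-1 : ℝ) 1) ∧
      ∀ x y, ∫ ω, 2 * φ ω x * φ ω y ∂P = k x y := by
  classical
  let _ : MeasurableSpace (E → Set.Icc (-1 : ℝ) 1) := borel _
  have : BorelSpace (E → Set.Icc (-1 : ℝ) 1) := ⟨rfl⟩
  have heval (x : E) : Continuous fun ω : E → Set.Icc (-1 : ℝ) 1 => (ω x : ℝ) :=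
    continuous_subtype_val.comp (continuous_apply x)
  let F : E × E → BoundedContinuousFunction (E → Set.Icc (-1 : ℝ) 1) ℝ := fun q =>
    BoundedContinuousFunction.mkOfCompact
      ⟨fun ω => 2 * (ω q.1 : ℝ) * ω q.2, (continuous_const.mul (heval _)).mul (heval _)⟩
  obtain ⟨μ, hμ⟩ := exists_probabilityMeasure_integral_eq F (fun q => k q.1 q.2) (by
    intro T δ hδ
    obtain ⟨I, _, W, p, hW, hW1, hWk⟩ :=
      hk.exists_finite_features (T.image Prod.fst ∪ T.image Prod.snd) hδ
    let ν : Measure (E → Set.Icc (-1 : ℝ) 1) :=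
      ∑ i, ENNReal.ofReal (W i) • Measure.dirac (p i)
    have hν : IsProbabilityMeasure ν := ⟨by
      simp [ν, ← ENNReal.ofReal_sum_of_nonneg fun i _ => hW i, hW1]⟩
    refine ⟨⟨ν, hν⟩, fun q hq => ?_⟩
    have hintg : ∫ ω, F q ω ∂ν = ∑ i, W i * (2 * (p i q.1 : ℝ) * p i q.2) := by
      rw [integral_finsetSum_measure fun i _ => (integrable_dirac
        (by simp)).smul_measure ENNReal.ofReal_ne_top]
      refine Finset.sum_congr rfl fun i _ => ?_
      rw [integral_smul_measure, integral_dirac, ENNReal.toReal_ofReal (hW i)]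
      rfl
    have := hWk q.1 (Finset.mem_union_left _ (Finset.mem_image_of_mem _ hq)) q.2
      (Finset.mem_union_right _ (Finset.mem_image_of_mem _ hq))
    rw [← hintg] at this
    exact this)
  exact ⟨E → Set.Icc (-1 : ℝ) 1, borel _, μ, fun ω x => ω x, inferInstance,
    fun x => (heval x).measurable, fun ω x => (ω x).2, fun x y => hμ (x, y)⟩

end IsPDSIKernel

/-! ### Product measures: composition of privacy and concentration -/

/-- The product of finitely many measures is monotone, with multiplicative constants. -/
lemma measure_pi_le_of_le_smul {ι D : Type} [Fintype ι] [MeasurableSpace D] {μ ν : Measure D}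
    [IsProbabilityMeasure μ] [IsProbabilityMeasure ν] {c : ENNReal} (hc0 : c ≠ 0) (hc : c ≠ ⊤)
    (h : μ ≤ c • ν) (O : Set (ι → D)) (hO : MeasurableSet O) :
    Measure.pi (fun _ : ι => μ) O ≤ c ^ Fintype.card ι * Measure.pi (fun _ : ι => ν) O := by
  have hC0 : c ^ Fintype.card ι ≠ 0 := pow_ne_zero _ hc0
  have hC : c ^ Fintype.card ι ≠ ⊤ := ENNReal.pow_ne_top hc
  -- The outer measure defining `Measure.pi` is the largest one bounded on boxes by the product of
  -- the sides, so a comparison on boxes suffices.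
  have key : ((c ^ Fintype.card ι)⁻¹ • Measure.pi (fun _ : ι => μ)).toOuterMeasure
      ≤ OuterMeasure.pi fun _ : ι => ν.toOuterMeasure := by
    rw [OuterMeasure.le_pi]
    intro s _
    have h1 : ∏ i, μ (s i) ≤ c ^ Fintype.card ι * ∏ i, ν (s i) := by
      calc ∏ i, μ (s i) ≤ ∏ i, c * ν (s i) :=
            Finset.prod_le_prod' fun i _ => h (s i)
        _ = _ := by rw [Finset.prod_mul_distrib, Finset.prod_const, Finset.card_univ]
    change (c ^ Fintype.card ι)⁻¹ * Measure.pi (fun _ : ι => μ) (Set.univ.pi s) ≤ ∏ i, ν (s i)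
    rw [Measure.pi_pi, mul_comm, ← div_eq_mul_inv]
    exact ENNReal.div_le_of_le_mul' h1
  have h2 : (c ^ Fintype.card ι)⁻¹ * Measure.pi (fun _ : ι => μ) O
      ≤ Measure.pi (fun _ : ι => ν) O := by
    conv_rhs => rw [Measure.pi, toMeasure_apply _ _ hO]
    exact key O
  rw [mul_comm, ← div_eq_mul_inv] at h2
  rw [mul_comm]
  exact (ENNReal.div_le_iff hC0 hC).1 h2

/-- Hoeffding's inequality for independent copies of a centered bounded variable. -/
lemma measure_pi_sum_ge_le {D : Type} [MeasurableSpace D] (ρ : Measure D) [IsProbabilityMeasure ρ]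
    (J : ℕ) {g : D → ℝ} (hg : Measurable g) (hb : ∀ q, g q ∈ Set.Icc (-4 : ℝ) 4)
    (h0 : ∫ q, g q ∂ρ = 0) {t : ℝ} (ht : 0 ≤ t) :
    (Measure.pi fun _ : Fin J => ρ).real {o | t ≤ ∑ j, g (o j)} ≤ Real.exp (-t ^ 2 / (32 * J)) := by
  have hind : ProbabilityTheory.iIndepFun (fun (j : Fin J) (o : Fin J → D) => g (o j))
      (Measure.pi fun _ : Fin J => ρ) :=
    ProbabilityTheory.iIndepFun_pi (X := fun _ => g) fun _ => hg.aemeasurable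
  have hsub : ∀ j ∈ (Finset.univ : Finset (Fin J)), ProbabilityTheory.HasSubgaussianMGF
      (fun o : Fin J → D => g (o j)) ((‖(4 : ℝ) - (-4)‖₊ / 2) ^ 2)
      (Measure.pi fun _ : Fin J => ρ) := by
    intro j _
    refine ProbabilityTheory.hasSubgaussianMGF_of_mem_Icc_of_integral_eq_zero
      (hg.comp (measurable_pi_apply j)).aemeasurable (ae_of_all _ fun o => hb _) ?_
    have hmp := measurePreserving_eval (fun _ : Fin J => ρ) j
    rwa [← hmp.map_eq, integral_map hmp.measurable.aemeasurable hg.aestronglyMeasurable] at h0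
  have h := ProbabilityTheory.HasSubgaussianMGF.measure_sum_ge_le_of_iIndepFun hind hsub ht
  -- An interval of length 8 gives variance proxy `(8/2)² = 16` per term, hence `32 J` in the
  -- exponent.
  refine h.trans_eq ?_
  congr 2
  simp only [Finset.sum_const, Finset.card_univ, Fintype.card_fin, nsmul_eq_mul, NNReal.coe_mul,
    NNReal.coe_natCast, NNReal.coe_pow, NNReal.coe_div, coe_nnnorm, NNReal.coe_ofNat]
  norm_num
  ring

/-! ### One round: weights, means and privacy -/

/-- The probability share that a feature value `a` gives to the three outcomes
`dummy`, `+1`, `-1` of a round. -/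
noncomputable def outcomeShare (t : Fin 3) (a : ℝ) : ℝ := ![0, (1 + a) / 2, (1 - a) / 2] t

/-- The sign carried by an outcome. -/
noncomputable def outcomeSign (t : Fin 3) : ℝ := ![0, 1, -1] t

/-- The statistic of an outcome whose mean is the fraction of true data points. -/
noncomputable def outcomeMass (t : Fin 3) : ℝ := ![-2, 1, 1] t

lemma outcomeShare_mem_Icc (t : Fin 3) {a : ℝ} (ha : a ∈ Set.Icc (-1 : ℝ) 1) :
    outcomeShare t a ∈ Set.Icc (0 : ℝ) 1 := by
  obtain ⟨h1, h2⟩ := ha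
  fin_cases t <;> simp [outcomeShare] <;> constructor <;> linarith

lemma measurable_outcomeShare (t : Fin 3) : Measurable (outcomeShare t) := by
  unfold outcomeShare
  fin_cases t <;> simp <;> fun_prop

section Round

variable {E Ω : Type} {φ : Ω → E → ℝ} {m : ℝ}

/-- The weight of an outcome: `m` from dummy points, and the shares of the data points. -/
noncomputable def roundWeight (φ : Ω → E → ℝ) (m : ℝ) (X : Multiset E) (q : Ω × Fin 3) : ℝ :=
  m + (X.map fun x => outcomeShare q.2 (φ q.1 x)).sum

noncomputable def roundDensity (φ : Ω → E → ℝ) (m : ℝ) (X : Multiset E) (q : Ω × Fin 3) : ℝ :=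
  roundWeight φ m X q / (3 * m + X.card)

lemma roundWeight_cons (x : E) (X : Multiset E) (q : Ω × Fin 3) :
    roundWeight φ m (x ::ₘ X) q = roundWeight φ m X q + outcomeShare q.2 (φ q.1 x) := by
  simp [roundWeight]
  ring

lemma le_roundWeight (hφ : ∀ ω x, φ ω x ∈ Set.Icc (-1 : ℝ) 1) (X : Multiset E) (q : Ω × Fin 3) :
    m ≤ roundWeight φ m X q := by
  induction X using Multiset.induction with
  | empty => simp [roundWeight]
  | cons x X ih =>
    rw [roundWeight_cons]
    linarith [(outcomeShare_mem_Icc q.2 (hφ q.1 x)).1]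

lemma sum_roundWeight (X : Multiset E) (ω : Ω) :
    ∑ t, roundWeight φ m X (ω, t) = 3 * m + X.card := by
  induction X using Multiset.induction with
  | empty => simp [roundWeight]
  | cons x X ih =>
    simp only [roundWeight_cons, Finset.sum_add_distrib, ih, Multiset.card_cons]
    simp [Fin.sum_univ_three, outcomeShare]
    ring

/-- The dummy weights of `+1` and `-1` cancel, and a data point contributes the difference of its
two shares. -/
lemma sum_sign_mul_roundWeight (X : Multiset E) (ω : Ω) :
    ∑ t, outcomeSign t * roundWeight φ m X (ω, t) = (X.map fun x => φ ω x).sum := by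
  induction X using Multiset.induction with
  | empty => simp [roundWeight, Fin.sum_univ_three, outcomeSign]
  | cons x X ih =>
    simp only [roundWeight_cons, mul_add, Finset.sum_add_distrib, ih, Multiset.map_cons,
      Multiset.sum_cons]
    simp [Fin.sum_univ_three, outcomeShare, outcomeSign]
    ring

/-- Dummies cancel because `-2 + 1 + 1 = 0`; the shares of a data point lie on the two signs and add
up to 1. -/
lemma sum_mass_mul_roundWeight (X : Multiset E) (ω : Ω) :
    ∑ t, outcomeMass t * roundWeight φ m X (ω, t) = X.card := by
  induction X using Multiset.induction with
  | empty =>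
    simp [roundWeight, Fin.sum_univ_three, outcomeMass]
    ring
  | cons x X ih =>
    simp only [roundWeight_cons, mul_add, Finset.sum_add_distrib, ih, Multiset.card_cons]
    simp [Fin.sum_univ_three, outcomeShare, outcomeMass]
    ring

lemma roundDensity_nonneg (hm : 0 < m) (hφ : ∀ ω x, φ ω x ∈ Set.Icc (-1 : ℝ) 1) (X : Multiset E)
    (q : Ω × Fin 3) : 0 ≤ roundDensity φ m X q :=
  div_nonneg (hm.le.trans (le_roundWeight hφ X q)) (by positivity)

lemma sum_roundDensity (hm : 0 < m) (X : Multiset E) (ω : Ω) :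
    ∑ t, roundDensity φ m X (ω, t) = 1 := by
  simp only [roundDensity, ← Finset.sum_div, sum_roundWeight]
  exact div_self (by positivity)

/-- The numerator grows by at most 1, which is at most `1/m` times its value since dummies alone
contribute `m`; the larger normalizer only helps. -/
lemma roundDensity_cons_le (hm : 0 < m) (hφ : ∀ ω x, φ ω x ∈ Set.Icc (-1 : ℝ) 1) (x : E)
    (X : Multiset E) (q : Ω × Fin 3) :
    roundDensity φ m (x ::ₘ X) q ≤ (1 + 1 / m) * roundDensity φ m X q := by
  have hw := le_roundWeight (m := m) hφ X q
  have hs := outcomeShare_mem_Icc q.2 (hφ q.1 x)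
  have hW : 0 < 3 * m + (X.card : ℝ) := by positivity
  have h1 : 1 ≤ roundWeight φ m X q / m := (one_le_div hm).2 hw
  rw [roundDensity, roundDensity, roundWeight_cons, Multiset.card_cons, ← mul_div_assoc]
  push_cast
  refine div_le_div₀ (by nlinarith [div_pos one_pos hm]) ?_ hW (by linarith)
  calc _ ≤ roundWeight φ m X q + roundWeight φ m X q / m := by linarith [hs.2]
    _ = _ := by ring

/-- Here the loss comes from the normalizer, which grows by 1 and is at least `m`. -/
lemma roundDensity_le_cons (hm : 0 < m) (hφ : ∀ ω x, φ ω x ∈ Set.Icc (-1 : ℝ) 1) (x : E)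
    (X : Multiset E) (q : Ω × Fin 3) :
    roundDensity φ m X q ≤ (1 + 1 / m) * roundDensity φ m (x ::ₘ X) q := by
  have hw := le_roundWeight (m := m) hφ X q
  have hs := outcomeShare_mem_Icc q.2 (hφ q.1 x)
  have hW : 0 < 3 * m + (X.card : ℝ) := by positivity
  rw [roundDensity, roundDensity, roundWeight_cons, Multiset.card_cons, ← mul_div_assoc]
  push_cast
  rw [div_le_div_iff₀ hW (by linarith)]
  have h1 : 1 ≤ (3 * m + (X.card : ℝ)) / m := by
    rw [one_le_div hm]
    linarith [(Nat.cast_nonneg X.card : (0 : ℝ) ≤ X.card)]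
  have h2 : 3 * m + ((X.card : ℝ) + 1) ≤ (1 + 1 / m) * (3 * m + X.card) := by
    calc _ ≤ (3 * m + (X.card : ℝ)) + (3 * m + (X.card : ℝ)) / m := by linarith
      _ = _ := by ring
  calc roundWeight φ m X q * (3 * m + ((X.card : ℝ) + 1))
      ≤ roundWeight φ m X q * ((1 + 1 / m) * (3 * m + X.card)) := by gcongr; linarith
    _ ≤ (roundWeight φ m X q + outcomeShare q.2 (φ q.1 x)) * ((1 + 1 / m) * (3 * m + X.card)) := by
        gcongr; linarith [hs.1]
    _ = _ := by ring

variable [MeasurableSpace Ω] {P : Measure Ω}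

/-- The law of one round: a random feature, together with an outcome drawn according to the
weights. -/
noncomputable def roundLaw (P : Measure Ω) (φ : Ω → E → ℝ) (m : ℝ) (X : Multiset E) :
    Measure (Ω × Fin 3) :=
  (P.prod Measure.count).withDensity fun q => ENNReal.ofReal (roundDensity φ m X q)

lemma measurable_roundDensity (hφm : ∀ x, Measurable fun ω => φ ω x) (X : Multiset E) :
    Measurable (roundDensity φ m X) := by
  refine Measurable.div_const ?_ _
  refine measurable_from_prod_countable_left fun t => ?_
  induction X using Multiset.induction with
  | empty => simp [roundWeight]
  | cons x X ih =>
    simp only [roundWeight_cons]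
    exact ih.add ((measurable_outcomeShare t).comp (hφm x))

lemma isProbabilityMeasure_roundLaw [IsProbabilityMeasure P] (hm : 0 < m)
    (hφ : ∀ ω x, φ ω x ∈ Set.Icc (-1 : ℝ) 1) (hφm : ∀ x, Measurable fun ω => φ ω x)
    (X : Multiset E) : IsProbabilityMeasure (roundLaw P φ m X) := by
  refine ⟨?_⟩
  have hmeas := (measurable_roundDensity (m := m) hφm X).ennreal_ofReal
  rw [roundLaw, withDensity_apply _ MeasurableSet.univ, Measure.restrict_univ,
    lintegral_prod _ hmeas.aemeasurable]
  simp only [lintegral_count, tsum_fintype]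
  simp only [← ENNReal.ofReal_sum_of_nonneg fun t _ => roundDensity_nonneg hm hφ X _,
    sum_roundDensity hm]
  simp

lemma integral_roundLaw [IsProbabilityMeasure P] (hm : 0 < m)
    (hφ : ∀ ω x, φ ω x ∈ Set.Icc (-1 : ℝ) 1) (hφm : ∀ x, Measurable fun ω => φ ω x)
    (X : Multiset E) {g : Ω × Fin 3 → ℝ} (hg : Measurable g) {c : ℝ} (hc : ∀ q, |g q| ≤ c) :
    ∫ q, g q ∂(roundLaw P φ m X)
      = (∫ ω, ∑ t, g (ω, t) * roundWeight φ m X (ω, t) ∂P) / (3 * m + X.card) := by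
  have hmeas := measurable_roundDensity (m := m) hφm X
  have hle (q : Ω × Fin 3) : roundDensity φ m X q ≤ 1 := by
    rw [← sum_roundDensity (φ := φ) hm X q.1]
    exact Finset.single_le_sum (f := fun t => roundDensity φ m X (q.1, t))
      (fun t _ => roundDensity_nonneg hm hφ X _) (Finset.mem_univ q.2)
  rw [roundLaw, integral_withDensity_eq_integral_toReal_smul hmeas.ennreal_ofReal
    (ae_of_all _ fun _ => ENNReal.ofReal_lt_top)]
  simp only [ENNReal.toReal_ofReal (roundDensity_nonneg hm hφ X _), smul_eq_mul]
  rw [integral_prod]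
  · rw [← integral_div]
    refine integral_congr_ae (ae_of_all _ fun ω => ?_)
    simp only [integral_count, Finset.sum_div, roundDensity]
    exact Finset.sum_congr rfl fun t _ => by ring
  · refine Integrable.of_bound (hmeas.mul hg).aestronglyMeasurable c (ae_of_all _ fun q => ?_)
    rw [Real.norm_eq_abs, abs_mul, abs_of_nonneg (roundDensity_nonneg hm hφ X q)]
    exact (mul_le_of_le_one_left (abs_nonneg _) (hle q)).trans (hc q)

lemma roundLaw_le_of_neighboring (hm : 0 < m) (hφ : ∀ ω x, φ ω x ∈ Set.Icc (-1 : ℝ) 1)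
    (hφm : ∀ x, Measurable fun ω => φ ω x) {δ : ℝ} (hδ : 1 / m ≤ δ) {X X' : Multiset E}
    (h : Neighboring X X') :
    roundLaw P φ m X ≤ ENNReal.ofReal (Real.exp δ) • roundLaw P φ m X' := by
  have hexp : 1 + 1 / m ≤ Real.exp δ := by linarith [Real.add_one_le_exp δ]
  have hdens (q : Ω × Fin 3) : roundDensity φ m X q ≤ Real.exp δ * roundDensity φ m X' q := by
    have h1 : roundDensity φ m X q ≤ (1 + 1 / m) * roundDensity φ m X' q := by
      obtain ⟨x, rfl | rfl⟩ := h
      · exact roundDensity_cons_le hm hφ x _ q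
      · exact roundDensity_le_cons hm hφ x _ q
    exact h1.trans (mul_le_mul_of_nonneg_right hexp (roundDensity_nonneg hm hφ X' q))
  rw [roundLaw, roundLaw,
    ← withDensity_smul _ (measurable_roundDensity hφm X').ennreal_ofReal]
  refine withDensity_mono (ae_of_all _ fun q => ?_)
  rw [Pi.smul_apply, smul_eq_mul, ← ENNReal.ofReal_mul (Real.exp_pos _).le]
  exact ENNReal.ofReal_le_ofReal (hdens q)

end Round

/-! ### The mechanism with independent rounds: privacy and error -/

lemma IsPDSIKernel.kde_mem_Icc {E : Type} [AddGroup E] {k : E → E → ℝ} (hk : IsPDSIKernel k)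
    (X : Multiset E) (y : E) : kde k X y ∈ Set.Icc (0 : ℝ) 1 := by
  have h : 0 ≤ (X.map fun x => k x y).sum ∧ (X.map fun x => k x y).sum ≤ X.card := by
    induction X using Multiset.induction with
    | empty => simp
    | cons x X ih =>
      have := hk.mem_Icc x y
      simp only [Multiset.map_cons, Multiset.sum_cons, Multiset.card_cons, Nat.cast_add,
        Nat.cast_one]
      constructor <;> linarith [this.1, this.2, ih.1, ih.2]
  exact ⟨div_nonneg h.1 (Nat.cast_nonneg _), div_le_one_of_le₀ h.2 (Nat.cast_nonneg _)⟩

lemma abs_projIcc_sub_le {a b : ℝ} (hb : b ∈ Set.Icc (0 : ℝ) 1) :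
    |(Set.projIcc (0 : ℝ) 1 zero_le_one a : ℝ) - b| ≤ |a - b| := by
  have h := Set.abs_projIcc_sub_projIcc (a := (0 : ℝ)) (b := 1) (c := a) (d := b) zero_le_one
  rwa [Set.projIcc_of_mem zero_le_one hb] at h

lemma measurable_outcome {Ω : Type} [MeasurableSpace Ω] (f : Fin 3 → ℝ) :
    Measurable fun q : Ω × Fin 3 => f q.2 :=
  (measurable_of_countable f).comp measurable_snd

lemma measurable_sign_mul {E Ω : Type} [MeasurableSpace Ω] {φ : Ω → E → ℝ}
    (hφm : ∀ x, Measurable fun ω => φ ω x) (y : E) :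
    Measurable fun q : Ω × Fin 3 => 2 * outcomeSign q.2 * φ q.1 y :=
  ((measurable_outcome outcomeSign).const_mul 2).mul ((hφm y).comp measurable_fst)

lemma abs_outcomeSign_le (t : Fin 3) : |outcomeSign t| ≤ 1 := by
  fin_cases t <;> simp [outcomeSign]

lemma outcomeMass_mem_Icc (t : Fin 3) : outcomeMass t ∈ Set.Icc (-2 : ℝ) 1 := by
  fin_cases t <;> simp [outcomeMass] <;> norm_num

section Mechanism

variable {E Ω : Type} [MeasurableSpace Ω]

/-- The function release mechanism built from `J` independent rounds. -/
noncomputable def featureMechanism (P : Measure Ω) [IsProbabilityMeasure P] (φ : Ω → E → ℝ)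
    (hφ : ∀ ω x, φ ω x ∈ Set.Icc (-1 : ℝ) 1) (hφm : ∀ x, Measurable fun ω => φ ω x)
    (J : ℕ) (m : ℝ) (hm : 0 < m) : FunctionReleaseMechanism E where
  Desc := Fin J → Ω × Fin 3
  curator X := Measure.pi fun _ => roundLaw P φ m X
  isProbabilityMeasure X :=
    have := isProbabilityMeasure_roundLaw (P := P) hm hφ hφm X
    inferInstance
  client o y := Set.projIcc 0 1 zero_le_one
    ((∑ j, 2 * outcomeSign (o j).2 * φ (o j).1 y) / ∑ j, outcomeMass (o j).2)
  measurable_client y := by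
    refine continuous_projIcc.measurable.comp (Measurable.div ?_ ?_)
    · exact Finset.measurable_sum _ fun j _ =>
        (measurable_sign_mul hφm y).comp (measurable_pi_apply j)
    · exact Finset.measurable_sum _ fun j _ =>
        (measurable_outcome outcomeMass).comp (measurable_pi_apply j)

variable {P : Measure Ω} [IsProbabilityMeasure P] {φ : Ω → E → ℝ}
  {hφ : ∀ ω x, φ ω x ∈ Set.Icc (-1 : ℝ) 1} {hφm : ∀ x, Measurable fun ω => φ ω x}
  {J : ℕ} {m : ℝ} {hm : 0 < m}

lemma isDP_featureMechanism {ε : ℝ} (hJ : J ≠ 0) (hε : J / m ≤ ε) :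
    (featureMechanism P φ hφ hφm J m hm).IsDP ε := by
  intro X X' h O hO
  have := isProbabilityMeasure_roundLaw (P := P) hm hφ hφm X
  have := isProbabilityMeasure_roundLaw (P := P) hm hφ hφm X'
  have hJ0 : (0 : ℝ) < J := by exact_mod_cast Nat.pos_of_ne_zero hJ
  have hδ : 1 / m ≤ ε / J := by
    rw [le_div_iff₀ hJ0]
    exact (by ring : 1 / m * (J : ℝ) = J / m).trans_le hε
  have h1 := measure_pi_le_of_le_smul (ι := Fin J) (by simpa using Real.exp_pos _)
    ENNReal.ofReal_ne_top (roundLaw_le_of_neighboring (P := P) hm hφ hφm hδ h) O hO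
  rw [Fintype.card_fin, ← ENNReal.ofReal_pow (Real.exp_pos _).le, ← Real.exp_nat_mul,
    mul_div_cancel₀ _ hJ0.ne'] at h1
  exact h1

lemma integral_sign_mul_roundLaw {k : E → E → ℝ} (hm : 0 < m)
    (hφ : ∀ ω x, φ ω x ∈ Set.Icc (-1 : ℝ) 1) (hφm : ∀ x, Measurable fun ω => φ ω x)
    (hφk : ∀ x y, ∫ ω, 2 * φ ω x * φ ω y ∂P = k x y) (X : Multiset E) (y : E) :
    ∫ q, 2 * outcomeSign q.2 * φ q.1 y ∂(roundLaw P φ m X)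
      = (X.map fun x => k x y).sum / (3 * m + X.card) := by
  have hb (ω : Ω) (x : E) : |φ ω x| ≤ 1 := abs_le.2 (hφ ω x)
  rw [integral_roundLaw hm hφ hφm X (c := 2) (measurable_sign_mul hφm y)]
  · congr 1
    have h1 (ω : Ω) : ∑ t, 2 * outcomeSign t * φ ω y * roundWeight φ m X (ω, t)
        = 2 * φ ω y * (X.map fun x => φ ω x).sum := by
      rw [← sum_sign_mul_roundWeight (m := m), Finset.mul_sum]
      exact Finset.sum_congr rfl fun t _ => by ring
    simp only [h1]
    -- Integrability is carried along in the induction so that the integral of the sum can be split.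
    suffices h : Integrable (fun ω => 2 * φ ω y * (X.map fun x => φ ω x).sum) P ∧
        ∫ ω, 2 * φ ω y * (X.map fun x => φ ω x).sum ∂P = (X.map fun x => k x y).sum from h.2
    clear h1
    induction X using Multiset.induction with
    | empty => simp
    | cons x X ih =>
      have hintg : Integrable (fun ω => 2 * φ ω x * φ ω y) P := by
        refine Integrable.of_bound (((hφm x).const_mul 2).mul (hφm y)).aestronglyMeasurable 2
          (ae_of_all _ fun ω => ?_)
        rw [Real.norm_eq_abs, abs_mul, abs_mul, abs_two]
        have := mul_le_one₀ (hb ω x) (abs_nonneg _) (hb ω y)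
        linarith
      have hsplit : (fun ω => 2 * φ ω y * ((x ::ₘ X).map fun x => φ ω x).sum)
          = fun ω => 2 * φ ω x * φ ω y + 2 * φ ω y * (X.map fun x => φ ω x).sum := by
        funext ω
        rw [Multiset.map_cons, Multiset.sum_cons]
        ring
      rw [hsplit]
      refine ⟨hintg.add ih.1, ?_⟩
      rw [integral_add hintg ih.1, hφk, ih.2, Multiset.map_cons, Multiset.sum_cons]
  · intro q
    rw [abs_mul, abs_mul, abs_two]
    have := mul_le_one₀ (abs_outcomeSign_le q.2) (abs_nonneg _) (hb q.1 y)
    linarith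

lemma integral_mass_roundLaw (hm : 0 < m)
    (hφ : ∀ ω x, φ ω x ∈ Set.Icc (-1 : ℝ) 1) (hφm : ∀ x, Measurable fun ω => φ ω x)
    (X : Multiset E) :
    ∫ q, outcomeMass q.2 ∂(roundLaw P φ m X) = X.card / (3 * m + X.card) := by
  rw [integral_roundLaw hm hφ hφm X (measurable_outcome outcomeMass) (c := 2)]
  · simp [sum_mass_mul_roundWeight]
  · intro q
    have := outcomeMass_mem_Icc q.2
    exact abs_le.2 ⟨this.1, this.2.trans one_le_two⟩

/-- If the data points outnumber the dummy points, the error of the mechanism has a sub-Gaussian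
tail. -/
lemma featureMechanism_error [AddGroup E] {k : E → E → ℝ} (hk : IsPDSIKernel k)
    (hφk : ∀ x y, ∫ ω, 2 * φ ω x * φ ω y ∂P = k x y) (hJ : J ≠ 0) (X : Multiset E)
    (hX : 3 * m ≤ X.card) (y : E) {β : ℝ} (hβ : 0 < β) :
    ENNReal.ofReal (1 - 3 * Real.exp (-(J * β ^ 2) / 512)) ≤
      (featureMechanism P φ hφ hφm J m hm).curator X
        {o | |((featureMechanism P φ hφ hφm J m hm).client o y : ℝ) - kde k X y| ≤ β} := by
  set τ := kde k X y with hτ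
  have hτ01 : τ ∈ Set.Icc (0 : ℝ) 1 := hk.kde_mem_Icc X y
  rcases lt_or_ge 1 β with hβ1 | hβ1
  -- Both values lie in `[0,1]`, so `β > 1` is trivial; `β ≤ 1` is needed later to bound the tail of
  -- the denominator by that of the numerator.
  · have huniv : {o | |((featureMechanism P φ hφ hφm J m hm).client o y : ℝ) - τ| ≤ β}
        = Set.univ := by
      refine Set.eq_univ_of_forall fun o => ?_
      have h := ((featureMechanism P φ hφ hφm J m hm).client o y).2
      rw [Set.mem_ofPred_eq, abs_le]
      constructor <;> linarith [h.1, h.2, hτ01.1, hτ01.2]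
    rw [huniv, measure_univ]
    exact ENNReal.ofReal_le_one.2 (by linarith [Real.exp_pos (-(J * β ^ 2) / 512)])
  have := isProbabilityMeasure_roundLaw (P := P) hm hφ hφm X
  have hJ0 : (0 : ℝ) < J := by exact_mod_cast Nat.pos_of_ne_zero hJ
  have hW : 0 < 3 * m + (X.card : ℝ) := by positivity
  have hn : (0 : ℝ) < X.card := by linarith
  set r : ℝ := X.card / (3 * m + X.card) with hr
  have hr2 : 1 / 2 ≤ r := by
    rw [hr, div_le_div_iff₀ two_pos hW]
    linarith
  have hr1 : r ≤ 1 := (div_le_one hW).2 (by linarith)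
  -- Linearizing the ratio: `g` has mean zero, and the error is `|∑ g|` divided by the total mass.
  -- The variable `b` controls that mass from below, by `J/2 - J/4`.
  let g : Ω × Fin 3 → ℝ := fun q => 2 * outcomeSign q.2 * φ q.1 y - τ * outcomeMass q.2
  let b : Ω × Fin 3 → ℝ := fun q => r - outcomeMass q.2
  have hsm : Measurable fun q : Ω × Fin 3 => 2 * outcomeSign q.2 * φ q.1 y :=
    measurable_sign_mul hφm y
  have hmm : Measurable fun q : Ω × Fin 3 => outcomeMass q.2 := measurable_outcome _
  have hsb (q : Ω × Fin 3) : |2 * outcomeSign q.2 * φ q.1 y| ≤ 2 := by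
    rw [abs_mul, abs_mul, abs_two]
    have := mul_le_one₀ (abs_outcomeSign_le q.2) (abs_nonneg _) (abs_le.2 (hφ q.1 y))
    linarith
  have hmb (q : Ω × Fin 3) : |outcomeMass q.2| ≤ 2 := by
    have := outcomeMass_mem_Icc q.2
    exact abs_le.2 ⟨this.1, this.2.trans one_le_two⟩
  have hgm : Measurable g := hsm.sub (hmm.const_mul τ)
  have hbm : Measurable b := measurable_const.sub hmm
  have hgb (q : Ω × Fin 3) : |g q| ≤ 4 := by
    have h1 : |τ * outcomeMass q.2| ≤ 2 := by
      rw [abs_mul, abs_of_nonneg hτ01.1]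
      exact (mul_le_of_le_one_left (abs_nonneg _) hτ01.2).trans (hmb q)
    exact (abs_sub _ _).trans (by linarith [hsb q])
  have hbb (q : Ω × Fin 3) : b q ∈ Set.Icc (-4 : ℝ) 4 := by
    have := outcomeMass_mem_Icc q.2
    constructor <;> simp only [b] <;> linarith [this.1, this.2]
  have hsi : Integrable (fun q : Ω × Fin 3 => 2 * outcomeSign q.2 * φ q.1 y) (roundLaw P φ m X) :=
    Integrable.of_bound hsm.aestronglyMeasurable 2 (ae_of_all _ hsb)
  have hmi : Integrable (fun q : Ω × Fin 3 => outcomeMass q.2) (roundLaw P φ m X) :=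
    Integrable.of_bound hmm.aestronglyMeasurable 2 (ae_of_all _ hmb)
  have hg0 : ∫ q, g q ∂(roundLaw P φ m X) = 0 := by
    simp only [g]
    rw [integral_sub hsi (hmi.const_mul τ), integral_const_mul, integral_mass_roundLaw hm hφ hφm,
      integral_sign_mul_roundLaw hm hφ hφm hφk, hτ, kde]
    field_simp
    ring
  have hb0 : ∫ q, b q ∂(roundLaw P φ m X) = 0 := by
    simp only [b]
    rw [integral_sub (integrable_const r) hmi, integral_mass_roundLaw hm hφ hφm]
    simp [hr]
  set μ : Measure (Fin J → Ω × Fin 3) := Measure.pi fun _ => roundLaw P φ m X with hμ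
  have ht : 0 ≤ J * β / 4 := by positivity
  have hexp : -(J * β / 4) ^ 2 / (32 * J) = -(J * β ^ 2) / 512 := by
    field_simp
    ring
  have b1 := measure_pi_sum_ge_le (roundLaw P φ m X) J hgm (fun q => abs_le.1 (hgb q)) hg0 ht
  have b2 := measure_pi_sum_ge_le (roundLaw P φ m X) J hgm.neg
    (fun q => abs_le.1 ((abs_neg (g q)).trans_le (hgb q)))
    (by simp only [Pi.neg_apply]; rw [integral_neg, hg0, neg_zero]) ht
  have b3 := measure_pi_sum_ge_le (roundLaw P φ m X) J hbm hbb hb0 (t := J / 4) (by positivity)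
  rw [hexp] at b1 b2
  have b3' : Real.exp (-(J / 4 : ℝ) ^ 2 / (32 * J)) ≤ Real.exp (-(J * β ^ 2) / 512) := by
    rw [Real.exp_le_exp, ← hexp]
    have : (J * β / 4) ^ 2 ≤ (J / 4 : ℝ) ^ 2 := by
      gcongr
      exact mul_le_of_le_one_right hJ0.le hβ1
    gcongr
  set good : Set (Fin J → Ω × Fin 3) :=
    {o | |((featureMechanism P φ hφ hφm J m hm).client o y : ℝ) - τ| ≤ β} with hgood
  have hgoodm : MeasurableSet good :=
    measurableSet_le (((featureMechanism P φ hφ hφm J m hm).measurable_client y).subtype_val.sub_const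
      τ).abs measurable_const
  have hsub : goodᶜ ⊆ {o | J * β / 4 ≤ ∑ j, g (o j)} ∪ {o | J * β / 4 ≤ ∑ j, (-g) (o j)}
      ∪ {o | (J : ℝ) / 4 ≤ ∑ j, b (o j)} := by
    intro o ho
    by_contra hcon
    simp only [Set.mem_union, Set.mem_ofPred_eq, not_or, not_le, Pi.neg_apply,
      Finset.sum_neg_distrib] at hcon
    obtain ⟨⟨h1, h2⟩, h3⟩ := hcon
    refine ho ?_
    simp only [hgood, Set.mem_ofPred_eq]
    refine (abs_projIcc_sub_le hτ01).trans ?_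
    simp only [b, Finset.sum_sub_distrib, Finset.sum_const, Finset.card_univ, Fintype.card_fin,
      nsmul_eq_mul] at h3
    have hB : J / 4 < ∑ j, outcomeMass (o j).2 := by nlinarith
    have hB0 : 0 < ∑ j, outcomeMass (o j).2 := lt_trans (by positivity) hB
    have hgs : ∑ j, g (o j) = ∑ j, 2 * outcomeSign (o j).2 * φ (o j).1 y
        - τ * ∑ j, outcomeMass (o j).2 := by
      simp only [g, Finset.sum_sub_distrib, Finset.mul_sum]
    rw [div_sub' hB0.ne', abs_div, abs_of_pos hB0, div_le_iff₀ hB0, mul_comm _ τ, ← hgs]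
    refine (abs_le.2 ⟨by linarith, h1.le⟩ : |∑ j, g (o j)| ≤ J * β / 4).trans ?_
    nlinarith
  have hbad : μ.real goodᶜ ≤ 3 * Real.exp (-(J * β ^ 2) / 512) := by
    calc μ.real goodᶜ ≤ _ := measureReal_mono hsub
      _ ≤ μ.real ({o | J * β / 4 ≤ ∑ j, g (o j)} ∪ {o | J * β / 4 ≤ ∑ j, (-g) (o j)})
          + μ.real {o | (J : ℝ) / 4 ≤ ∑ j, b (o j)} := measureReal_union_le _ _
      _ ≤ μ.real {o | J * β / 4 ≤ ∑ j, g (o j)} + μ.real {o | J * β / 4 ≤ ∑ j, (-g) (o j)}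
          + μ.real {o | (J : ℝ) / 4 ≤ ∑ j, b (o j)} := by
        gcongr
        exact measureReal_union_le _ _
      _ ≤ _ := by linarith
  rw [probReal_compl_eq_one_sub hgoodm] at hbad
  change _ ≤ μ good
  rw [← ofReal_measureReal]
  exact ENNReal.ofReal_le_ofReal (by linarith)

end Mechanism

/-! ### Trading success probability for accuracy by guessing -/

/-- The interval `[-β, β]` is covered by `N` equal intervals with explicit centers. -/
lemma exists_grid_center_near {N : ℕ} (hN : N ≠ 0) {β δ : ℝ} (hβ : 0 < β) (hδ : |δ| ≤ β) :
    ∃ i : Fin N, |β * (2 * (i : ℝ) + 1 - N) / N - δ| ≤ β / N := by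
  have hN0 : (0 : ℝ) < N := by exact_mod_cast Nat.pos_of_ne_zero hN
  obtain ⟨h1, h2⟩ := abs_le.1 hδ
  set z : ℝ := N * (δ + β) / (2 * β) with hz
  have hz0 : 0 ≤ z := div_nonneg (mul_nonneg hN0.le (by linarith)) (by linarith)
  have hzN : z ≤ N := by
    rw [hz, div_le_iff₀ (by linarith)]
    nlinarith
  obtain ⟨i, hi1, hi2⟩ : ∃ i : Fin N, (i : ℝ) ≤ z ∧ z ≤ i + 1 := by
    by_cases h : ⌊z⌋₊ < N
    · exact ⟨⟨⌊z⌋₊, h⟩, Nat.floor_le hz0, (Nat.lt_floor_add_one z).le⟩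
    · have hNz : (N : ℝ) ≤ z := (Nat.le_floor_iff hz0).1 (not_lt.1 h)
      have hcast : ((N - 1 : ℕ) : ℝ) = N - 1 := by
        rw [Nat.cast_sub (Nat.one_le_iff_ne_zero.2 hN), Nat.cast_one]
      refine ⟨⟨N - 1, Nat.sub_one_lt hN⟩, ?_, ?_⟩ <;> simp only [hcast] <;> linarith
  refine ⟨i, ?_⟩
  have heq : β * (2 * (i : ℝ) + 1 - N) / N - δ = β / N * (2 * (i + 1 / 2 - z)) := by
    rw [hz]
    field_simp
    ring
  rw [heq, abs_mul, abs_of_pos (div_pos hβ hN0)]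
  refine mul_le_of_le_one_right (by positivity) (abs_le.2 ⟨?_, ?_⟩) <;> linarith

namespace FunctionReleaseMechanism

variable {E : Type}

/-- The uniform distribution on `Fin N`. -/
noncomputable def gridLaw (N : ℕ) : Measure (Fin N) := (N : ENNReal)⁻¹ • Measure.count

lemma isProbabilityMeasure_gridLaw {N : ℕ} (hN : N ≠ 0) : IsProbabilityMeasure (gridLaw N) := by
  refine ⟨?_⟩
  rw [gridLaw, Measure.smul_apply, Measure.count_univ]
  simp [ENNReal.inv_mul_cancel, hN]

/-- The mechanism that refines the output of `M` by a random guess: the released function is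
shifted by a uniformly random point of a grid of `N` points in `[-β, β]`. -/
noncomputable def withRandomShift (M : FunctionReleaseMechanism E) (N : ℕ) (hN : N ≠ 0) (β : ℝ) :
    FunctionReleaseMechanism E where
  Desc := M.Desc × Fin N
  curator X := (M.curator X).prod (gridLaw N)
  isProbabilityMeasure X :=
    have := isProbabilityMeasure_gridLaw hN
    inferInstance
  client o y := Set.projIcc 0 1 zero_le_one
    ((M.client o.1 y : ℝ) + β * (2 * ((o.2 : ℕ) : ℝ) + 1 - N) / N)
  measurable_client y := by
    refine continuous_projIcc.measurable.comp (Measurable.add ?_ ?_)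
    · exact ((M.measurable_client y).subtype_val).comp measurable_fst
    · exact (measurable_of_countable fun i : Fin N => β * (2 * ((i : ℕ) : ℝ) + 1 - N) / N).comp
        measurable_snd

lemma IsDP.withRandomShift {M : FunctionReleaseMechanism E} {ε : ℝ} (h : M.IsDP ε) {N : ℕ}
    (hN : N ≠ 0) (β : ℝ) : (M.withRandomShift N hN β).IsDP ε := by
  intro X X' hX O hO
  have := isProbabilityMeasure_gridLaw hN
  have hle : M.curator X ≤ ENNReal.ofReal (Real.exp ε) • M.curator X' :=
    Measure.le_iff.2 fun O hO => h X X' hX O hO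
  change (M.curator X).prod (gridLaw N) O ≤ _ * (M.curator X').prod (gridLaw N) O
  rw [Measure.prod_apply hO, Measure.prod_apply hO, ← smul_eq_mul, ← lintegral_smul_measure]
  exact lintegral_mono' hle le_rfl

/-- For each good description some grid shift brings the value within `β / N` of `τ`; it is drawn
with probability `1/N`, independently of the description. -/
lemma withRandomShift_error (M : FunctionReleaseMechanism E) {N : ℕ} (hN : N ≠ 0) {β : ℝ}
    (hβ : 0 < β) (X : Multiset E) (y : E) {τ : ℝ} (hτ : τ ∈ Set.Icc (0 : ℝ) 1) :
    (N : ENNReal)⁻¹ * M.curator X {o | |(M.client o y : ℝ) - τ| ≤ β} ≤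
      (M.withRandomShift N hN β).curator X
        {o | |((M.withRandomShift N hN β).client o y : ℝ) - τ| ≤ β / N} := by
  have := isProbabilityMeasure_gridLaw hN
  set M' := M.withRandomShift N hN β
  set good : Set M.Desc := {o | |(M.client o y : ℝ) - τ| ≤ β} with hgood
  have hgoodm : MeasurableSet good :=
    measurableSet_le ((M.measurable_client y).subtype_val.sub_const τ).abs measurable_const
  have hS : MeasurableSet {o | |(M'.client o y : ℝ) - τ| ≤ β / N} :=
    measurableSet_le ((M'.measurable_client y).subtype_val.sub_const τ).abs measurable_const
  change _ ≤ (M.curator X).prod (gridLaw N) _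
  rw [Measure.prod_apply hS, ← lintegral_indicator_const hgoodm]
  refine lintegral_mono fun o => ?_
  by_cases ho : o ∈ good
  swap
  · rw [Set.indicator_of_notMem ho]
    exact zero_le
  rw [Set.indicator_of_mem ho]
  obtain ⟨i, hi⟩ := exists_grid_center_near hN hβ (δ := τ - M.client o y)
    (by rw [abs_sub_comm]; exact ho)
  calc (N : ENNReal)⁻¹ = gridLaw N {i} := by
        rw [gridLaw, Measure.smul_apply, Measure.count_singleton, smul_eq_mul, mul_one]
    _ ≤ _ := by
        refine measure_mono (Set.singleton_subset_iff.2 ?_)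
        change |(Set.projIcc (0 : ℝ) 1 zero_le_one
          ((M.client o y : ℝ) + β * (2 * ((i : ℕ) : ℝ) + 1 - N) / N) : ℝ) - τ| ≤ β / N
        refine (abs_projIcc_sub_le hτ).trans (le_trans (le_of_eq ?_) hi)
        congr 1
        ring

lemma approximates_withRandomShift [AddGroup E] {k : E → E → ℝ} (hk : IsPDSIKernel k)
    (M : FunctionReleaseMechanism E) {N : ℕ} (hN : N ≠ 0) {α β η p : ℝ} (hβ : 0 < β)
    (hβα : β ≤ N * α) (hη : 1 - η ≤ p / N) {X : Multiset E}
    (hM : ∀ y, ENNReal.ofReal p ≤ M.curator X {o | |(M.client o y : ℝ) - kde k X y| ≤ β}) :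
    (M.withRandomShift N hN β).Approximates k α η X := by
  intro y
  have hN0 : (0 : ℝ) < N := by exact_mod_cast Nat.pos_of_ne_zero hN
  calc ENNReal.ofReal (1 - η) ≤ ENNReal.ofReal (p / N) := ENNReal.ofReal_le_ofReal hη
    _ = (N : ENNReal)⁻¹ * ENNReal.ofReal p := by
        rw [ENNReal.ofReal_div_of_pos hN0, ENNReal.ofReal_natCast, ENNReal.div_eq_inv_mul]
    _ ≤ (N : ENNReal)⁻¹ * M.curator X {o | |(M.client o y : ℝ) - kde k X y| ≤ β} := by
        gcongr
        exact hM y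
    _ ≤ _ := M.withRandomShift_error hN hβ X y (hk.kde_mem_Icc X y)
    _ ≤ _ := by
        refine measure_mono fun o ho => ?_
        rw [Set.mem_ofPred_eq] at ho ⊢
        refine ho.trans ?_
        rw [div_le_iff₀ hN0]
        linarith

/-- The mechanism that releases the constant function `1/2`. -/
noncomputable def half (E : Type) : FunctionReleaseMechanism E where
  Desc := Unit
  curator _ := Measure.dirac ()
  isProbabilityMeasure _ := inferInstance
  client _ _ := ⟨1 / 2, by norm_num, by norm_num⟩
  measurable_client _ := measurable_const

lemma isDP_half {ε : ℝ} (hε : 0 < ε) : (half E).IsDP ε := by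
  intro X X' _ O _
  change Measure.dirac () O ≤ _ * Measure.dirac () O
  exact le_mul_of_one_le_left' (by simpa using hε.le)

end FunctionReleaseMechanism

/-! ### Choice of parameters in the three ranges of `η` -/

/-- The mechanism with `J` random features: it is private, and its error has a sub-Gaussian tail
on datasets of size at least `3J/ε`. -/
theorem IsPDSIKernel.exists_mechanism {E : Type} [AddCommGroup E] {k : E → E → ℝ}
    (hk : IsPDSIKernel k) {ε : ℝ} (hε : 0 < ε) {J : ℕ} (hJ : J ≠ 0) :
    ∃ M : FunctionReleaseMechanism E, M.IsDP ε ∧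
      ∀ X : Multiset E, 3 * (J / ε) ≤ X.card → ∀ (y : E) (β : ℝ), 0 < β →
        ENNReal.ofReal (1 - 3 * Real.exp (-(J * β ^ 2) / 512)) ≤
          M.curator X {o | |(M.client o y : ℝ) - kde k X y| ≤ β} := by
  obtain ⟨Ω, _, P, φ, _, hφm, hφ, hφk⟩ := hk.exists_random_features
  have hJ0 : (0 : ℝ) < J := by exact_mod_cast Nat.pos_of_ne_zero hJ
  have hm : 0 < J / ε := div_pos hJ0 hε
  refine ⟨featureMechanism P φ hφ hφm J (J / ε) hm, isDP_featureMechanism hJ ?_, ?_⟩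
  · rw [div_div_cancel₀ hJ0.ne']
  · intro X hX y β hβ
    exact featureMechanism_error hk hφk hJ X hX y hβ

theorem mainTheorem6 :
    ∃ C : ℝ, 0 < C ∧
      ∀ (d : ℕ) (k : EuclideanSpace ℝ (Fin d) → EuclideanSpace ℝ (Fin d) → ℝ),
        IsPDSIKernel k →
        ∀ ε α η : ℝ, 0 < ε → α ∈ Set.Ioo (0 : ℝ) 1 → η ∈ Set.Ioo (0 : ℝ) 1 →
          ∃ M : FunctionReleaseMechanism (EuclideanSpace ℝ (Fin d)),
            M.IsDP ε ∧
            ∀ X : Multiset (EuclideanSpace ℝ (Fin d)),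
              C * (Real.log (1 / η) / (ε * α ^ 2)) ≤ (X.card : ℝ) →
              M.Approximates k α η X := by
  refine ⟨40000, by norm_num, fun d k hk ε α η hε hα hη => ?_⟩
  obtain ⟨hα0, hα1⟩ := hα
  obtain ⟨hη0, hη1⟩ := hη
  set L := Real.log (1 / η) with hL
  have hηL : η = Real.exp (-L) := by
    rw [hL, one_div, Real.log_inv, neg_neg, Real.exp_log hη0]
  have hL0 : 0 < L := Real.log_pos ((one_lt_div hη0).2 hη1)
  have hηle : 1 - η ≤ L := by linarith [Real.add_one_le_exp (-L)]
  have hα2 : 0 < α ^ 2 := by positivity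
  -- A number of rounds of order `L / α²` is affordable.
  have hsize {J : ℕ} {n : ℝ} (hJ : (J : ℝ) ≤ 13000 * (L / α ^ 2))
      (hn : 40000 * (L / (ε * α ^ 2)) ≤ n) : 3 * (J / ε) ≤ n := by
    refine le_trans ?_ hn
    calc 3 * (J / ε) ≤ 3 * (13000 * (L / α ^ 2) / ε) := by gcongr
      _ = 39000 * (L / (ε * α ^ 2)) := by field_simp; ring
      _ ≤ _ := by gcongr; norm_num
  rcases lt_or_ge L (α ^ 2 / 4) with hLα | hLα
  · -- A blind guess succeeds with probability of order `α`.
    set N := ⌈1 / (2 * α)⌉₊ with hNdef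
    have hNpos : 0 < N := Nat.ceil_pos.2 (by positivity)
    have hN1 : 1 / (2 * α) ≤ N := Nat.le_ceil _
    have hN2 : (N : ℝ) < 1 / (2 * α) + 1 := Nat.ceil_lt_add_one (by positivity)
    have hN0 : (0 : ℝ) < N := by exact_mod_cast hNpos
    refine ⟨(FunctionReleaseMechanism.half _).withRandomShift N hNpos.ne' (1 / 2),
      (FunctionReleaseMechanism.isDP_half hε).withRandomShift _ _, fun X _ => ?_⟩
    refine FunctionReleaseMechanism.approximates_withRandomShift hk _ hNpos.ne' (p := 1)
      (by norm_num) ?_ ?_ fun y => ?_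
    · rw [div_le_iff₀ (by positivity)] at hN1
      linarith
    · refine hηle.trans (hLα.le.trans ?_)
      rw [le_div_iff₀ hN0]
      have : α * (1 / (2 * α)) = 1 / 2 := by field_simp
      nlinarith
    · have h := hk.kde_mem_Icc X y
      have huniv : {o | |((FunctionReleaseMechanism.half (EuclideanSpace ℝ (Fin d))).client o y : ℝ)
          - kde k X y| ≤ 1 / 2} = Set.univ := by
        refine Set.eq_univ_of_forall fun o => ?_
        change |(1 / 2 : ℝ) - kde k X y| ≤ 1 / 2
        exact abs_le.2 ⟨by linarith [h.2], by linarith [h.1]⟩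
      rw [huniv, measure_univ, ENNReal.ofReal_one]
  -- This absorbs the rounding of `J` up to an integer into the bound by a multiple of `L / α²`.
  have hone : 1 ≤ 4 * (L / α ^ 2) := by
    rw [← mul_div_assoc, le_div_iff₀ hα2]
    linarith
  rcases lt_or_ge L (1 / 4) with hL4 | hL4
  · -- A coarse estimate is refined by guessing.
    set N := ⌊1 / (2 * L)⌋₊ with hNdef
    have hN1 : (N : ℝ) ≤ 1 / (2 * L) := Nat.floor_le (by positivity)
    have hN2 : 1 / (2 * L) < N + 1 := Nat.lt_floor_add_one _
    have hL2 : 2 < 1 / (2 * L) := by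
      rw [lt_div_iff₀ (by positivity)]
      linarith
    have hN0 : (0 : ℝ) < N := by linarith
    have hNne : N ≠ 0 := by
      rintro h
      rw [h] at hN0
      simp at hN0
    have hNL : 1 ≤ 4 * L * N := by
      have : L * (1 / (2 * L)) = 1 / 2 := by field_simp
      nlinarith
    -- Since `2560 / 512 = 5` and `3 exp(-5) ≤ 1/2`, accuracy `N * α` holds with probability at
    -- least `1/2`; guessing leaves `1/(2N) ≥ L ≥ 1 - η`.
    set J := ⌈2560 / (N * α) ^ 2⌉₊ with hJdef
    have hJ0 : 0 < J := Nat.ceil_pos.2 (by positivity)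
    have hJ1 : 2560 / (N * α) ^ 2 ≤ J := Nat.le_ceil _
    have hJ2 : (J : ℝ) < 2560 / (N * α) ^ 2 + 1 := Nat.ceil_lt_add_one (by positivity)
    have hJ3 : 2560 / (N * α) ^ 2 ≤ 10240 * (L / α ^ 2) := by
      rw [← mul_div_assoc, div_le_div_iff₀ (by positivity) hα2]
      have : 1 ≤ 4 * L * N ^ 2 := by nlinarith
      nlinarith
    obtain ⟨M, hM, hMX⟩ := hk.exists_mechanism hε hJ0.ne'
    refine ⟨M.withRandomShift N hNne (N * α), hM.withRandomShift _ _, fun X hX => ?_⟩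
    refine FunctionReleaseMechanism.approximates_withRandomShift hk M hNne (p := 1 / 2)
      (by positivity) le_rfl ?_ fun y => ?_
    · refine hηle.trans ?_
      rw [le_div_iff₀ hN0]
      rw [le_div_iff₀ (by positivity)] at hN1
      linarith
    · refine le_trans (ENNReal.ofReal_le_ofReal ?_)
        (hMX X (hsize (by linarith) hX) y (N * α) (by positivity))
      rw [div_le_iff₀ (by positivity)] at hJ1
      have h5 : 6 ≤ Real.exp 5 := by linarith [Real.add_one_le_exp (5 : ℝ)]
      have h6 : Real.exp (-(J * (N * α) ^ 2) / 512) ≤ Real.exp (-5) :=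
        Real.exp_le_exp.2 (by linarith)
      have h7 : Real.exp (-5) ≤ 1 / 6 := by
        rw [Real.exp_neg, inv_eq_one_div]
        exact one_div_le_one_div_of_le (by norm_num) h5
      linarith
  -- As `4608 / 512 = 9` and `8 * L ≥ 2`, the tail is at most `3 exp(-L) exp(-2) ≤ η`.
  · set J := ⌈4608 * (L / α ^ 2)⌉₊ with hJdef
    have hJ0 : 0 < J := Nat.ceil_pos.2 (by positivity)
    have hJ1 : 4608 * (L / α ^ 2) ≤ J := Nat.le_ceil _
    have hJ2 : (J : ℝ) < 4608 * (L / α ^ 2) + 1 := Nat.ceil_lt_add_one (by positivity)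
    obtain ⟨M, hM, hMX⟩ := hk.exists_mechanism hε hJ0.ne'
    refine ⟨M, hM, fun X hX y => ?_⟩
    refine le_trans (ENNReal.ofReal_le_ofReal ?_) (hMX X (hsize (by linarith) hX) y α hα0)
    rw [← mul_div_assoc, div_le_iff₀ hα2] at hJ1
    have h1 : Real.exp (-(J * α ^ 2) / 512) ≤ Real.exp (-L) * Real.exp (-2) := by
      rw [← Real.exp_add]
      exact Real.exp_le_exp.2 (by linarith)
    have h2 : Real.exp (-2) ≤ 1 / 3 := by
      rw [Real.exp_neg, inv_eq_one_div]
      exact one_div_le_one_div_of_le (by norm_num) (by linarith [Real.add_one_le_exp (2 : ℝ)])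
    have h3 := mul_le_mul_of_nonneg_left h2 (Real.exp_pos (-L)).le
    linarith
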